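/- Let $F$ be a finite 4-regular multigraph (loops and parallel edges allowed); each edge consists of two half-edges, and each vertex is incident with four half-edges. A circuit is a directed closed trail, considered up to cyclic permutation. A circuit partition of $F$ is a partition of $E(F)$ into pairwise edge-disjoint circuits. An Euler system is a circuit partition which contains exactly one circuit for each connected component of $F$. Each circuit partition directs every edge of $F$; two circuit partitions respect the same edge directions if they direct every edge in the same way. A signed version of an Euler system $C$ designates, for each vertex $v$, one of the two passages of $C$ through $v$ as $v^+$ and the other as $v^-$; write these passages as $h_v^1,v^+,h_v^2$ and $h_v^3,v^-,h_v^4$, where $h_v^1,h_v^3$ are the half-edges along which $C$ arrives at $v$ and $h_v^2,h_v^4$ are those along which it leaves $v$. Let $C_1(C,v)$ be the closed trail that follows a circuit of $C$ from $v^-$ to $v^+$, leaving $v$ along $h_v^4$ and returning along $h_v^1$. For a circuit partition $P$, the touch-graph $Tch(P)$ has a vertex for each circuit of $P$ and an edge $e_w$ for each $w\in V(F)$. The two half-edges of $e_w$ correspond to the two passages of circuits of $P$ through $w$, each being incident on the circuit to which the passage belongs. If $h$ is a half-edge of $F$ at $w$, let $\overline h$ be the half-edge of $e_w$ corresponding to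 the passage of $P$ that involves $h$. A closed walk $W$ in $F$ projects to a closed walk $\overline W$ in $Tch(P)$: each passage of $W$ that arrives at $w$ along $h$ and leaves along $k$ gives a passage along $e_w$ from $\overline h$ to $\overline k$ if $\overline h\ne\overline k$, and gives nothing if $\overline h=\overline k$. Given a signed version of an Euler system $C$, direct $Tch(P)$ so that the initial half-edge of $e_w$ is $\overline{h_w^1}$ for every $w$, and let $M^0_{\mathbb R}(C,P)$ be the $V(F)\times V(F)$ matrix whose $vw$ entry is the number of times $\overline{C_1(C,v)}$ traverses $e_w$ in the positive direction minus the number of times it traverses $e_w$ in the negative direction. Suppose $C$ and $C'$ are Euler systems of $F$ which respect the same edge directions, and consider arbitrary signed versions of $C$ and $C'$. Then the matrix $M^0_{\mathbb R}(C,C')$ is invertible, and there is a $V(F)\times V(F)$ matrix $\Delta$ with the following properties. 1. Every diagonal entry of $\Delta$ is $\pm1$, and every other entry of $\Delta$ is $0$. 2. $M^0_{\mathbb R}(C',C)=\Delta\cdot M^0_{\mathbb R}(C,C')^{-1}\cdot\Delta$. 3. If $P$ is any circuit partition that respects the same edge directions as $C$ and $C'$, then $M^0_{\mathbb R}(C',P)=M^0_{\mathbb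 R}(C',C)\cdot\Delta\cdot M^0_{\mathbb R}(C,P)\cdot\Delta$. -/

import Mathlib

/-- The cyclically consecutive pairs of entries of a cyclic sequence `(a₁, …, aₖ)`:
`(a₁, a₂), …, (aₖ₋₁, aₖ), (aₖ, a₁)`. -/
def cyclicSteps {α : Type*} (γ : Cycle α) : Multiset (α × α) :=
  Quotient.liftOn γ (fun l => (↑(l.zip (l.rotate 1)) : Multiset (α × α))) (by
    rintro l _ ⟨n, rfl⟩
    refine Quotient.sound ?_
    have h : (l.rotate n).zip ((l.rotate n).rotate 1) = (l.zip (l.rotate 1)).rotate n := by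
      rw [List.rotate_rotate, Nat.add_comm n 1, ← List.rotate_rotate]
      exact (List.zipWith_rotate_distrib _ _ _ _ (by simp)).symm
    rw [h]
    exact (List.rotate_perm _ _).symm)

/-- A 4-regular multigraph (loops and parallel edges allowed), given by half-edges:
`V` is the set of vertices, `H` the set of half-edges, `inc h` is the vertex on which `h` is
incident, and `{h, opp h}` is the edge that contains `h`. -/
structure FourRegularGraph (V : Type*) (H : Type*) where
  inc : H → V
  opp : H → H
  opp_opp : ∀ h, opp (opp h) = h
  opp_ne : ∀ h, opp h ≠ h
  four_regular : ∀ v, {h | inc h = v}.ncard = 4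

namespace FourRegularGraph

variable {V : Type*} {H : Type*} (F : FourRegularGraph V H)

/-- Two vertices lie in the same connected component. -/
def Connected (u v : V) : Prop :=
  Relation.ReflTransGen (fun a b => ∃ h, F.inc h = a ∧ F.inc (F.opp h) = b) u v

/-- A closed walk `v₁, h₁, h₁', v₂, h₂, h₂', …, vₖ, hₖ, hₖ', v₁`, up to cyclic permutation, is
recorded by the cyclic sequence `(h₁, …, hₖ)`; here `hᵢ' = opp hᵢ` and `vᵢ = inc hᵢ`. -/
def IsClosedWalk (γ : Cycle H) : Prop :=
  γ ≠ Cycle.nil ∧ ∀ p ∈ cyclicSteps γ, F.inc (F.opp p.1) = F.inc p.2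

/-- A circuit is a closed walk that uses no edge twice (in either direction). -/
def IsCircuit (γ : Cycle H) : Prop :=
  F.IsClosedWalk γ ∧ γ.Nodup ∧ ∀ h ∈ γ, F.opp h ∉ γ

/-- A partition of the edge set into edge-disjoint (directed) circuits. -/
structure CircuitPartition where
  circuits : Set (Cycle H)
  isCircuit : ∀ γ ∈ circuits, F.IsCircuit γ
  partition : ∀ h, ∃! γ, γ ∈ circuits ∧ (h ∈ γ ∨ F.opp h ∈ γ)

/-- A circuit partition each of whose circuits traverses all the edges of a connected component,
i.e., a collection of Euler circuits, one in each connected component. -/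
structure EulerSystem extends F.CircuitPartition where
  euler : ∀ γ ∈ circuits, ∀ h ∈ γ, ∀ k, F.Connected (F.inc h) (F.inc k) →
    k ∈ γ ∨ F.opp k ∈ γ

variable {F}

namespace CircuitPartition

variable (P : F.CircuitPartition)

/-- `h` is the initial half-edge of its edge, in the direction in which the circuits of `P`
traverse that edge. -/
def Initial (h : H) : Prop := ∃ γ ∈ P.circuits, h ∈ γ

/-- The two circuit partitions respect the same edge directions. -/
def SameDirections (P Q : F.CircuitPartition) : Prop := ∀ h, P.Initial h ↔ Q.Initial h

/-- `…, h, v, k, …` is a passage of a circuit of `P` through the vertex `v`: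
the circuit arrives at `v` along the half-edge `h` and leaves `v` along the half-edge `k`. -/
def Passage (v : V) (h k : H) : Prop :=
  F.inc k = v ∧ ∃ γ ∈ P.circuits, ∃ x, (x, k) ∈ cyclicSteps γ ∧ F.opp x = h

/-- The image of a half-edge `h` of `F` under the projection onto the half-edges of the
touch-graph of `P`.  The half-edges of the touch-graph are the single transitions of `P`, that is,
the pairs of half-edges which appear together in a passage of `P`; the edge of the touch-graph
corresponding to `v ∈ V(F)` consists of the two single transitions of `P` at `v`. The image
of `h` is the single transition that contains `h`. -/
def proj (h : H) : Set H :=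
  {k | k = h ∨ ∃ v, P.Passage v h k ∨ P.Passage v k h}

open Classical in
/-- Let `D` be the directed version of the touch-graph of `P` in which the edge `e_w` has the
initial half-edge `init w`, for every `w ∈ V(F)`. This is the vector `z_D` of the closed walk in
the touch-graph onto which a closed walk `W` of `F` projects: a passage of `W` that arrives at `w`
along `h` and leaves `w` along `k` becomes a passage through `e_w` from the half-edge `proj h` to
the half-edge `proj k` if these differ, and disappears if they are equal. So it
contributes `1` to the `w` coordinate if `proj h` is the initial half-edge of `e_w` and `proj k` is
not, `-1` in the reverse case, and `0` if `proj h = proj k`. -/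
noncomputable def z (init : V → Set H) (W : Cycle H) (w : V) : ℝ :=
  ((cyclicSteps W).map fun p =>
    if F.inc p.2 = w ∧ P.proj (F.opp p.1) ≠ P.proj p.2 then
      if P.proj (F.opp p.1) = init w then (1 : ℝ) else -1
    else 0).sum

end CircuitPartition

namespace EulerSystem

/-- A signed version of `C`: at each vertex `v` one of the two passages of `C` through `v` is
designated as `v⁺` and the other as `v⁻`. In the notation `h_v¹, v⁺, h_v²` and `h_v³, v⁻, h_v⁴` for
these passages, the four half-edges are `plusIn v`, `plusOut v`, `minusIn v`, `minusOut v`. -/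
structure SignedVersion (C : F.EulerSystem) where
  plusIn : V → H
  plusOut : V → H
  minusIn : V → H
  minusOut : V → H
  plus_passage : ∀ v, C.Passage v (plusIn v) (plusOut v)
  minus_passage : ∀ v, C.Passage v (minusIn v) (minusOut v)
  plus_ne_minus : ∀ v, plusOut v ≠ minusOut v

namespace SignedVersion

variable {C : F.EulerSystem} (S : C.SignedVersion)

/-- `W` is the closed trail obtained by following the circuit of `C` from `v⁻` to `v⁺`. -/
def IsFundamentalCircuit (v : V) (W : Cycle H) : Prop :=
  ∃ l₁ l₂ : List H, (↑((S.minusOut v :: l₁) ++ (S.plusOut v :: l₂)) : Cycle H) ∈ C.circuits ∧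
    W = ↑(S.minusOut v :: l₁)

theorem mem_of_step {α : Type*} {γ : Cycle α} {x y : α} (h : (x, y) ∈ cyclicSteps γ) : y ∈ γ := by
  induction γ using Quotient.inductionOn with
  | _ l =>
    have h' : (x, y) ∈ l.zip (l.rotate 1) := h
    exact List.mem_rotate.1 (List.of_mem_zip h').2

theorem exists_fundamentalCircuit (v : V) : ∃ W, S.IsFundamentalCircuit v W := by
  obtain ⟨hp, γ, hγ, x, hx, -⟩ := S.plus_passage v
  obtain ⟨hm, γ', hγ', x', hx', -⟩ := S.minus_passage v
  have h1 := mem_of_step hx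
  have h2 := mem_of_step hx'
  have h3 := C.euler γ hγ _ h1 (S.minusOut v)
    (by rw [hp, hm]; exact Relation.ReflTransGen.refl)
  have hγγ : γ' = γ := (C.partition (S.minusOut v)).unique ⟨hγ', Or.inl h2⟩ ⟨hγ, h3⟩
  subst hγγ
  induction γ' using Quotient.inductionOn with
  | _ l =>
    obtain ⟨s, t, hl⟩ := List.append_of_mem (show S.minusOut v ∈ l from h2)
    have h1' : S.plusOut v ∈ l := h1
    have hmem : S.plusOut v ∈ t ++ s := by
      rw [hl] at h1'
      have := S.plus_ne_minus v
      simp only [List.mem_append, List.mem_cons] at h1' ⊢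
      tauto
    obtain ⟨l₁, l₂, hl'⟩ := List.append_of_mem hmem
    refine ⟨_, l₁, l₂, ?_, rfl⟩
    have hr : (↑((S.minusOut v :: l₁) ++ (S.plusOut v :: l₂)) : Cycle H) = (↑l : Cycle H) := by
      rw [Cycle.coe_eq_coe, hl, List.cons_append, ← hl', ← List.cons_append]
      exact List.isRotated_append
    rw [hr]
    exact hγ

/-- The fundamental circuit `C₁(C, v)`, which follows `C` from `v⁻` to `v⁺`. It
leaves `v` along `h_v⁴` and returns to `v` along `h_v¹`. -/
noncomputable def fundamentalCircuit (v : V) : Cycle H :=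
  (S.exists_fundamentalCircuit v).choose

/-- The standard matrix `M⁰_ℝ(C, P)` of a signed Euler system `C` and a circuit partition `P`.
The edge `e_w` of the touch-graph of `P` is directed so that the image of `h_w¹` is its initial
half-edge, and the row of `v` is the vector `z_D` of the projection of `C₁(C, v)`. -/
noncomputable def M (P : F.CircuitPartition) : Matrix V V ℝ :=
  fun v w => P.z (fun u => P.proj (S.plusIn u)) (S.fundamentalCircuit v) w

end SignedVersion

end EulerSystem

end FourRegularGraph

/-! Fix the common edge directions and record a directed closed walk by its traversal numbers, which
form a flow. If `a` is the edge arriving at `w` along $h_w^1$, the $w$ coordinate of the projection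
to $Tch(P)$ is `f a - f (P.next a)` (`z_eq_traversals_sub`), so it is linear in the flow `f`. A flow
whose coordinates for $P = C$ all vanish is constant along each Euler circuit, hence on each
component, so its coordinates for every $P$ vanish too. Since $M^0(C, C) = 1$ (`M_self`),
subtracting a combination of the fundamental circuits of $C$ reduces any flow to this case: its $P$
coordinates are its $C$ coordinates times $M^0(C, P)$ (`flow_eq_sum_mul_M`). Applied to the
fundamental circuits of $C'$, this gives property 3. The matrix $\Delta$ records where the two
signed versions choose different arrivals at `w`, which negates the coordinate. The case $P = C'$
gives invertibility and property 2. -/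

section CyclicSteps

variable {α : Type*}

/-! ### Cyclic sequences and traversal numbers. -/

theorem map_fst_cyclicSteps (γ : Cycle α) : (cyclicSteps γ).map Prod.fst = γ.toMultiset := by
  induction γ using Quotient.inductionOn with
  | _ l =>
    change (↑((l.zip (l.rotate 1)).map Prod.fst) : Multiset α) = ↑l
    rw [List.map_fst_zip (by simp)]

theorem map_snd_cyclicSteps (γ : Cycle α) : (cyclicSteps γ).map Prod.snd = γ.toMultiset := by
  induction γ using Quotient.inductionOn with
  | _ l =>
    change (↑((l.zip (l.rotate 1)).map Prod.snd) : Multiset α) = ↑l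
    rw [List.map_snd_zip (by simp)]
    exact Multiset.coe_eq_coe.2 (List.rotate_perm _ _)

theorem mem_cycle_toMultiset {γ : Cycle α} {x : α} : x ∈ γ.toMultiset ↔ x ∈ γ := by
  induction γ using Quotient.inductionOn with
  | _ l => exact Iff.rfl

theorem nodup_cycle_toMultiset {γ : Cycle α} : γ.toMultiset.Nodup ↔ γ.Nodup := by
  induction γ using Quotient.inductionOn with
  | _ l => exact Iff.rfl

theorem exists_cyclicSteps_left {γ : Cycle α} {x : α} :
    x ∈ γ ↔ ∃ y, (x, y) ∈ cyclicSteps γ := by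
  rw [← mem_cycle_toMultiset, ← map_fst_cyclicSteps]
  simp

theorem exists_cyclicSteps_right {γ : Cycle α} {y : α} :
    y ∈ γ ↔ ∃ x, (x, y) ∈ cyclicSteps γ := by
  rw [← mem_cycle_toMultiset, ← map_snd_cyclicSteps]
  simp

theorem cyclicSteps_cons (x : α) (l : List α) :
    cyclicSteps (↑(x :: l) : Cycle α) = ↑((x :: l).zip (l ++ [x])) := by
  change (↑((x :: l).zip ((x :: l).rotate 1)) : Multiset (α × α)) = _
  simp

/-- The consecutive pairs in `x, l, y`, with the last pair split off; the other pairs do not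
depend on `y`. -/
theorem exists_zip_append_singleton (x : α) (l : List α) :
    ∃ (s : List (α × α)) (a : α), ∀ y, (x :: l).zip (l ++ [y]) = s ++ [(a, y)] := by
  induction l generalizing x with
  | nil => exact ⟨[], x, fun y => rfl⟩
  | cons b l ih =>
    obtain ⟨s, a, h⟩ := ih b
    exact ⟨(x, b) :: s, a, fun y => by simpa using h y⟩

theorem eq_of_cyclicSteps_eq {β : Type*} (f : α → β) {γ : Cycle α}
    (h : ∀ p ∈ cyclicSteps γ, f p.1 = f p.2) {x y : α} (hx : x ∈ γ) (hy : y ∈ γ) :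
    f x = f y := by
  induction γ using Quotient.inductionOn with
  | _ l =>
    have key : ∀ x ∈ l, ∀ (h0 : 0 < l.length), f x = f l[0] := by
      intro x hx h0
      obtain ⟨i, hi, rfl⟩ := List.getElem_of_mem hx
      clear hx
      induction i with
      | zero => rfl
      | succ i ih =>
        rw [← ih (by omega)]
        have hmem : (l[i], l[i + 1]) ∈ l.zip (l.rotate 1) := by
          refine List.mem_iff_getElem.2 ⟨i, by simp; omega, ?_⟩
          simp [List.getElem_rotate, Nat.mod_eq_of_lt hi]
        exact (h _ hmem).symm
    have h0 : 0 < l.length := List.length_pos_of_mem hx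
    rw [key x hx h0, key y hy h0]

open Classical in
/-- The number of times a closed walk traverses each of its entries. -/
noncomputable def traversals (W : Cycle α) (x : α) : ℝ :=
  ((cyclicSteps W).map fun p => if p.1 = x then (1 : ℝ) else 0).sum

open Classical in
theorem traversals_eq_sum_snd (W : Cycle α) (x : α) :
    traversals W x = ((cyclicSteps W).map fun p => if p.2 = x then (1 : ℝ) else 0).sum := by
  have h1 := congrArg (fun m : Multiset α => (m.map fun y => if y = x then (1 : ℝ) else 0).sum)
    ((map_fst_cyclicSteps W).trans (map_snd_cyclicSteps W).symm)
  simp only [Multiset.map_map, Function.comp_def] at h1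
  exact h1

end CyclicSteps

namespace FourRegularGraph

variable {V : Type*} {H : Type*} {F : FourRegularGraph V H}

theorem opp_injective : Function.Injective F.opp := fun a b h => by
  rw [← F.opp_opp a, h, F.opp_opp]

/-! ### Transitions of a circuit partition, and flows. -/

namespace CircuitPartition

variable {P Q : F.CircuitPartition}

/-- A circuit of `P` traverses `k` immediately after `x`. -/
def Step (P : F.CircuitPartition) (x k : H) : Prop :=
  ∃ γ ∈ P.circuits, (x, k) ∈ cyclicSteps γ

theorem circuit_unique {γ γ' : Cycle H} {h : H} (hγ : γ ∈ P.circuits) (hγ' : γ' ∈ P.circuits)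
    (h1 : h ∈ γ ∨ F.opp h ∈ γ) (h2 : h ∈ γ' ∨ F.opp h ∈ γ') : γ = γ' :=
  (P.partition h).unique ⟨hγ, h1⟩ ⟨hγ', h2⟩

theorem Step.initial_left {x k : H} (h : P.Step x k) : P.Initial x := by
  obtain ⟨γ, hγ, h⟩ := h
  exact ⟨γ, hγ, exists_cyclicSteps_left.2 ⟨k, h⟩⟩

theorem Step.initial_right {x k : H} (h : P.Step x k) : P.Initial k := by
  obtain ⟨γ, hγ, h⟩ := h
  exact ⟨γ, hγ, exists_cyclicSteps_right.2 ⟨x, h⟩⟩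

theorem Step.inc_opp {x k : H} (h : P.Step x k) : F.inc (F.opp x) = F.inc k := by
  obtain ⟨γ, hγ, h⟩ := h
  exact (P.isCircuit γ hγ).1.2 _ h

theorem Initial.exists_step {x : H} (h : P.Initial x) : ∃ k, P.Step x k := by
  obtain ⟨γ, hγ, h⟩ := h
  obtain ⟨k, hk⟩ := exists_cyclicSteps_left.1 h
  exact ⟨k, γ, hγ, hk⟩

theorem Initial.exists_step_to {k : H} (h : P.Initial k) : ∃ x, P.Step x k := by
  obtain ⟨γ, hγ, h⟩ := h
  obtain ⟨x, hx⟩ := exists_cyclicSteps_right.1 h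
  exact ⟨x, γ, hγ, hx⟩

theorem Initial.not_opp {h : H} (h1 : P.Initial h) : ¬ P.Initial (F.opp h) := by
  rintro ⟨γ', hγ', h2⟩
  obtain ⟨γ, hγ, h1⟩ := h1
  obtain rfl := circuit_unique hγ hγ' (Or.inl h1) (Or.inr h2)
  exact (P.isCircuit γ hγ).2.2 h h1 h2

theorem Step.right_unique {x k k' : H} (h : P.Step x k) (h' : P.Step x k') : k = k' := by
  obtain ⟨γ, hγ, h⟩ := h
  obtain ⟨γ', hγ', h'⟩ := h'
  obtain rfl := circuit_unique hγ hγ' (Or.inl (exists_cyclicSteps_left.2 ⟨k, h⟩))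
    (Or.inl (exists_cyclicSteps_left.2 ⟨k', h'⟩))
  have hn : ((cyclicSteps γ).map Prod.fst).Nodup := by
    rw [map_fst_cyclicSteps]
    exact nodup_cycle_toMultiset.2 (P.isCircuit γ hγ).2.1
  exact congrArg Prod.snd (Multiset.inj_on_of_nodup_map hn _ h _ h' rfl)

theorem Step.left_unique {x x' k : H} (h : P.Step x k) (h' : P.Step x' k) : x = x' := by
  obtain ⟨γ, hγ, h⟩ := h
  obtain ⟨γ', hγ', h'⟩ := h'
  obtain rfl := circuit_unique hγ hγ' (Or.inl (exists_cyclicSteps_right.2 ⟨x, h⟩))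
    (Or.inl (exists_cyclicSteps_right.2 ⟨x', h'⟩))
  have hn : ((cyclicSteps γ).map Prod.snd).Nodup := by
    rw [map_snd_cyclicSteps]
    exact nodup_cycle_toMultiset.2 (P.isCircuit γ hγ).2.1
  exact congrArg Prod.fst (Multiset.inj_on_of_nodup_map hn _ h _ h' rfl)

open Classical in
/-- The half-edge along which `P` leaves the vertex that it reaches through `x`. -/
noncomputable def next (P : F.CircuitPartition) (x : H) : H :=
  if h : ∃ k, P.Step x k then h.choose else x

/-- At initial half-edges the default value in `next` is never taken. -/
theorem Initial.step_next {x : H} (h : P.Initial x) : P.Step x (P.next x) := by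
  rw [next, dif_pos h.exists_step]
  exact h.exists_step.choose_spec

theorem Step.next_eq {x k : H} (h : P.Step x k) : P.next x = k :=
  h.initial_left.step_next.right_unique h

theorem passage_iff {v : V} {h k : H} :
    P.Passage v h k ↔ F.inc k = v ∧ P.Step (F.opp h) k := by
  constructor
  · rintro ⟨hv, γ, hγ, x, hx, rfl⟩
    exact ⟨hv, γ, hγ, by rwa [F.opp_opp]⟩
  · rintro ⟨hv, γ, hγ, hx⟩
    exact ⟨hv, γ, hγ, _, hx, F.opp_opp h⟩

/-- At most two edges are directed into a vertex. -/
theorem eq_of_arrivals {w : V} {x y z : H} (hx : P.Initial x) (hy : P.Initial y)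
    (hz : P.Initial z) (hxw : F.inc (F.opp x) = w) (hyw : F.inc (F.opp y) = w)
    (hzw : F.inc (F.opp z) = w) (hxy : x ≠ y) (hzx : z ≠ x) : z = y := by
  classical
  by_contra hzy
  have sx := hx.step_next
  have sy := hy.step_next
  have no : ∀ {a b : H}, P.Initial a → P.Initial b → F.opp a ≠ b := fun ha hb h =>
    ha.not_opp (h ▸ hb)
  have hfin : {h | F.inc h = w}.Finite :=
    Set.finite_of_ncard_ne_zero (by rw [F.four_regular]; decide)
  -- Three arrivals, together with the departures that follow two of them, would be five distinct
  -- half-edges at `w`.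
  have hsub : (↑({F.opp x, F.opp y, F.opp z, P.next x, P.next y} : Finset H) : Set H) ⊆
      {h | F.inc h = w} := by
    intro h hh
    simp only [Finset.coe_insert, Finset.coe_singleton, Set.mem_insert_iff,
      Set.mem_singleton_iff] at hh
    rcases hh with rfl | rfl | rfl | rfl | rfl
    · exact hxw
    · exact hyw
    · exact hzw
    · exact sx.inc_opp.symm.trans hxw
    · exact sy.inc_opp.symm.trans hyw
  have hle := Set.ncard_le_ncard hsub hfin
  rw [F.four_regular, Set.ncard_coe_finset] at hle
  have hn : P.next x ≠ P.next y := fun h => hxy (sx.left_unique (h ▸ sy))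
  have h5 : ({F.opp x, F.opp y, F.opp z, P.next x, P.next y} : Finset H).card = 5 := by
    simp [Finset.card_insert_of_notMem, opp_injective.eq_iff, hxy, Ne.symm hzx, Ne.symm hzy, hn,
      no hx sx.initial_right, no hx sy.initial_right, no hy sx.initial_right,
      no hy sy.initial_right, no hz sx.initial_right, no hz sy.initial_right]
  omega

/-- At most two edges are directed out of a vertex. -/
theorem eq_of_departures {w : V} {x y z : H} (hx : P.Initial x) (hy : P.Initial y)
    (hz : P.Initial z) (hxw : F.inc x = w) (hyw : F.inc y = w)
    (hzw : F.inc z = w) (hxy : x ≠ y) (hzx : z ≠ x) : z = y := by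
  obtain ⟨x', sx⟩ := hx.exists_step_to
  obtain ⟨y', sy⟩ := hy.exists_step_to
  obtain ⟨z', sz⟩ := hz.exists_step_to
  have h := eq_of_arrivals sx.initial_left sy.initial_left sz.initial_left
    (sx.inc_opp.trans hxw) (sy.inc_opp.trans hyw) (sz.inc_opp.trans hzw)
    (fun h => hxy (sx.right_unique (h ▸ sy))) (fun h => hzx (sz.right_unique (h ▸ sx)))
  exact sz.right_unique (h ▸ sy)

theorem mem_proj_opp {x h : H} (hx : P.Initial x) :
    h ∈ P.proj (F.opp x) ↔ h = F.opp x ∨ P.Step x h := by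
  simp only [proj, Set.mem_ofPred_eq, passage_iff, F.opp_opp]
  constructor
  · rintro (h | ⟨v, ⟨-, h⟩ | ⟨-, h⟩⟩)
    · exact Or.inl h
    · exact Or.inr h
    · exact absurd h.initial_right hx.not_opp
  · rintro (h | h)
    · exact Or.inl h
    · exact Or.inr ⟨_, Or.inl ⟨rfl, h⟩⟩

theorem mem_proj {k h : H} (hk : P.Initial k) :
    h ∈ P.proj k ↔ h = k ∨ P.Step (F.opp h) k := by
  simp only [proj, Set.mem_ofPred_eq, passage_iff]
  constructor
  · rintro (h | ⟨v, ⟨-, h⟩ | ⟨-, h⟩⟩)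
    · exact Or.inl h
    · exact absurd h.initial_left hk.not_opp
    · exact Or.inr h
  · rintro (h | h)
    · exact Or.inl h
    · exact Or.inr ⟨_, Or.inr ⟨rfl, h⟩⟩

/-- Each single transition of `P` consists of one arriving and one departing half-edge, so it is
determined by either of them. -/
theorem proj_opp_eq_proj_iff {x k : H} (hx : P.Initial x) (hk : P.Initial k) :
    P.proj (F.opp x) = P.proj k ↔ P.Step x k := by
  constructor
  · intro h
    have h1 : k ∈ P.proj (F.opp x) := h ▸ (mem_proj hk).2 (Or.inl rfl)
    rcases (mem_proj_opp hx).1 h1 with h1 | h1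
    · exact absurd (h1 ▸ hk) hx.not_opp
    · exact h1
  · intro s
    ext h
    rw [mem_proj_opp hx, mem_proj hk]
    constructor
    · rintro (rfl | h1)
      · exact Or.inr (by rwa [F.opp_opp])
      · exact Or.inl (h1.right_unique s)
    · rintro (rfl | h1)
      · exact Or.inr s
      · exact Or.inl (by rw [s.left_unique h1, F.opp_opp])

theorem proj_opp_eq_proj_opp_iff {x a : H} (hx : P.Initial x) (ha : P.Initial a) :
    P.proj (F.opp x) = P.proj (F.opp a) ↔ x = a := by
  refine ⟨fun h => ?_, fun h => h ▸ rfl⟩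
  have h1 : F.opp x ∈ P.proj (F.opp a) := h ▸ (mem_proj_opp hx).2 (Or.inl rfl)
  rcases (mem_proj_opp ha).1 h1 with h1 | h1
  · exact opp_injective h1
  · exact absurd h1.initial_right hx.not_opp

/-- A closed walk which traverses every edge in the direction given by `P`. -/
def IsDirectedWalk (P : F.CircuitPartition) (W : Cycle H) : Prop :=
  ∀ p ∈ cyclicSteps W, P.Initial p.1 ∧ P.Initial p.2 ∧ F.inc (F.opp p.1) = F.inc p.2

theorem IsDirectedWalk.of_sameDirections {W : Cycle H} (h : P.IsDirectedWalk W)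
    (hPQ : P.SameDirections Q) : Q.IsDirectedWalk W := fun p hp =>
  ⟨(hPQ _).1 (h p hp).1, (hPQ _).1 (h p hp).2.1, (h p hp).2.2⟩

/-- The identity holds step by step: a step `(x, k)` at `w` contributes $[x = a] - [k =
\mathrm{next}\, a]$. Both terms agree on a transition of `P`; otherwise exactly one of them is 1. -/
theorem z_eq_traversals_sub {W : Cycle H} (hW : P.IsDirectedWalk W) {init : V → Set H} {w : V}
    {a : H} (ha : P.Initial a) (haw : F.inc (F.opp a) = w) (hinit : init w = P.proj (F.opp a)) :
    P.z init W w = traversals W a - traversals W (P.next a) := by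
  classical
  have sa := ha.step_next
  rw [traversals_eq_sum_snd W (P.next a), traversals, z, ← Multiset.sum_map_sub]
  refine congrArg Multiset.sum (Multiset.map_congr rfl ?_)
  rintro ⟨x, k⟩ hp
  obtain ⟨hx, hk, hxk⟩ := hW _ hp
  simp only at hx hk hxk ⊢
  simp only [hinit, ne_eq, proj_opp_eq_proj_iff hx hk, proj_opp_eq_proj_opp_iff hx ha]
  by_cases hw : F.inc k = w
  · by_cases hs : P.Step x k
    · have : x = a ↔ k = P.next a :=
        ⟨fun h => hs.right_unique (h ▸ sa), fun h => hs.left_unique (h ▸ sa)⟩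
      simp only [hs, not_true, and_false, if_false, this, sub_self]
    · by_cases hxa : x = a
      · have hk' : k ≠ P.next a := fun h => hs (by rw [h, hxa]; exact sa)
        rw [if_pos ⟨hw, hs⟩, if_pos hxa, if_neg hk', sub_zero]
        simp [hxa]
      -- The only departures from `w` are `P.next a` and `P.next x`, and the latter would make the
      -- step a transition of `P`.
      · have hk' : k = P.next a := by
          by_contra hne
          have sx := hx.step_next
          have h1 : P.next a ≠ P.next x := fun h => hxa (sx.left_unique (h ▸ sa))
          have := eq_of_departures sa.initial_right sx.initial_right hk
            (sa.inc_opp.symm.trans haw) (sx.inc_opp.symm.trans (hxk.trans hw)) hw h1 hne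
          exact hs (this ▸ sx)
        have hs' : ¬ P.Step x (P.next a) := hk' ▸ hs
        have hw' : F.inc (P.next a) = w := hk' ▸ hw
        simp [hw', hs', hxa, hk']
  · have h1 : x ≠ a := by
      rintro rfl
      exact hw (hxk.symm.trans haw)
    have h2 : k ≠ P.next a := by
      rintro rfl
      exact hw (sa.inc_opp.symm.trans haw)
    simp [hw, h1, h2]

/-- Conservation of flow at every vertex, with respect to the edge directions of `P`. -/
def IsFlow (P : F.CircuitPartition) (f : H → ℝ) : Prop :=
  ∀ a a' b b', P.Initial a → P.Initial a' → P.Initial b → P.Initial b' → a ≠ a' → b ≠ b' →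
    F.inc (F.opp a) = F.inc b → F.inc (F.opp a') = F.inc b → F.inc b' = F.inc b →
    f a + f a' = f b + f b'

theorem IsDirectedWalk.isFlow {W : Cycle H} (hW : P.IsDirectedWalk W) :
    P.IsFlow (traversals W) := by
  classical
  intro a a' b b' ha ha' hb hb' hab hbb h1 h2 h3
  rw [traversals_eq_sum_snd W b, traversals_eq_sum_snd W b', traversals, traversals,
    ← Multiset.sum_map_add, ← Multiset.sum_map_add]
  refine congrArg Multiset.sum (Multiset.map_congr rfl ?_)
  rintro ⟨x, k⟩ hp
  obtain ⟨hx, hk, hxk⟩ := hW _ hp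
  simp only at hx hk hxk ⊢
  by_cases hw : F.inc k = F.inc b
  · have e1 : x ≠ a → x = a' := eq_of_arrivals ha ha' hx h1 h2 (hxk.trans hw) hab
    have e2 : k ≠ b → k = b' := eq_of_departures hb hb' hk rfl h3 hw hbb
    have l1 : ((if x = a then (1 : ℝ) else 0) + if x = a' then 1 else 0) = 1 := by
      by_cases h : x = a
      · subst h; simp [hab]
      · obtain rfl := e1 h; simp [h]
    have l2 : ((if k = b then (1 : ℝ) else 0) + if k = b' then 1 else 0) = 1 := by
      by_cases h : k = b
      · subst h; simp [hbb]
      · obtain rfl := e2 h; simp [h]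
    rw [l1, l2]
  · have n1 : x ≠ a := by rintro rfl; exact hw (hxk.symm.trans h1)
    have n2 : x ≠ a' := by rintro rfl; exact hw (hxk.symm.trans h2)
    have n3 : k ≠ b := by rintro rfl; exact hw rfl
    have n4 : k ≠ b' := by rintro rfl; exact hw h3
    simp [n1, n2, n3, n4]

theorem IsFlow.sub_sum {ι : Type*} {s : Finset ι} {f : H → ℝ} {c : ι → ℝ} {g : ι → H → ℝ}
    (hf : P.IsFlow f) (hg : ∀ i, P.IsFlow (g i)) :
    P.IsFlow fun h => f h - ∑ i ∈ s, c i * g i h := by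
  intro a a' b b' ha ha' hb hb' hab hbb h1 h2 h3
  have e := hf a a' b b' ha ha' hb hb' hab hbb h1 h2 h3
  have e' : (∑ i ∈ s, c i * g i a) + ∑ i ∈ s, c i * g i a' =
      (∑ i ∈ s, c i * g i b) + ∑ i ∈ s, c i * g i b' := by
    rw [← Finset.sum_add_distrib, ← Finset.sum_add_distrib]
    refine Finset.sum_congr rfl fun i _ => ?_
    rw [← mul_add, ← mul_add, hg i a a' b b' ha ha' hb hb' hab hbb h1 h2 h3]
  linarith

/-- Conservation at the vertex makes the coordinate change sign when the other arrival is used; this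
is the source of the signs in $\Delta$. -/
theorem IsFlow.sub_next {f : H → ℝ} (hf : P.IsFlow f) {a a' : H} (ha : P.Initial a)
    (ha' : P.Initial a') (hne : a ≠ a') (hinc : F.inc (F.opp a) = F.inc (F.opp a')) :
    f a' - f (P.next a') = -(f a - f (P.next a)) := by
  have s := ha.step_next
  have s' := ha'.step_next
  have := hf a a' _ _ ha ha' s.initial_right s'.initial_right hne
    (fun h => hne (s.left_unique (h ▸ s'))) s.inc_opp (hinc ▸ s.inc_opp)
    (by rw [← s.inc_opp, ← s'.inc_opp, hinc])
  linarith

end CircuitPartition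

/-! ### Standard matrices of Euler systems. -/

namespace EulerSystem

open CircuitPartition

/-- Edges that meet at a vertex lie in one component, hence on one circuit of `C`. -/
theorem eq_of_inc_eq (C : F.EulerSystem) {f : H → ℝ}
    (hf : ∀ x k, C.Step x k → f x = f k) {x k : H} (hx : C.Initial x) (hk : C.Initial k)
    (hxk : F.inc (F.opp x) = F.inc k) : f x = f k := by
  obtain ⟨γ, hγ, h⟩ := hx
  have hkγ : k ∈ γ :=
    (C.euler γ hγ x h k (Relation.ReflTransGen.single ⟨x, rfl, hxk⟩)).resolve_right
      fun h' => hk.not_opp ⟨γ, hγ, h'⟩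
  exact eq_of_cyclicSteps_eq f (fun p hp => hf _ _ ⟨γ, hγ, hp⟩) h hkγ

namespace SignedVersion

variable {C : F.EulerSystem} (S : C.SignedVersion)

/-- The edge along which `C` arrives at `v` in the passage `v⁺`, represented by its initial
half-edge. -/
def plusArrival (v : V) : H := F.opp (S.plusIn v)

theorem opp_plusArrival (v : V) : F.opp (S.plusArrival v) = S.plusIn v := F.opp_opp _

theorem step_plusArrival (v : V) : C.Step (S.plusArrival v) (S.plusOut v) :=
  (passage_iff.1 (S.plus_passage v)).2

theorem inc_plusOut (v : V) : F.inc (S.plusOut v) = v := (S.plus_passage v).1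

theorem inc_minusOut (v : V) : F.inc (S.minusOut v) = v := (S.minus_passage v).1

theorem inc_plusArrival (v : V) : F.inc (F.opp (S.plusArrival v)) = v :=
  (S.step_plusArrival v).inc_opp.trans (S.inc_plusOut v)

theorem initial_plusArrival (v : V) : C.Initial (S.plusArrival v) :=
  (S.step_plusArrival v).initial_left

/-- The steps of `C₁(C, v)` are steps of `C`, except for the one that returns to the start. -/
theorem cyclicSteps_fundamentalCircuit (v : V) : ∃ s : Multiset (H × H),
    (∀ p ∈ s, C.Step p.1 p.2) ∧
      cyclicSteps (S.fundamentalCircuit v) = (S.plusArrival v, S.minusOut v) ::ₘ s := by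
  obtain ⟨l₁, l₂, hγ, hW⟩ : S.IsFundamentalCircuit v (S.fundamentalCircuit v) :=
    (S.exists_fundamentalCircuit v).choose_spec
  -- Taking `y` to be `S.plusOut v` gives a stretch of `C`; taking it to be `S.minusOut v` closes
  -- the trail. Only the last pair differs.
  obtain ⟨s, a, hs⟩ := exists_zip_append_singleton (S.minusOut v) l₁
  have hsub : ∀ p ∈ s ++ [(a, S.plusOut v)], C.Step p.1 p.2 := by
    intro p hp
    refine ⟨_, hγ, ?_⟩
    have e : (S.minusOut v :: l₁ ++ S.plusOut v :: l₂).zip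
        (l₁ ++ S.plusOut v :: l₂ ++ [S.minusOut v]) =
        (s ++ [(a, S.plusOut v)]) ++ (S.plusOut v :: l₂).zip (l₂ ++ [S.minusOut v]) := by
      rw [← hs, ← List.zip_append (by simp)]
      simp
    rw [List.cons_append, cyclicSteps_cons, ← List.cons_append, e]
    exact List.mem_append_left _ hp
  have ha : a = S.plusArrival v :=
    (hsub (a, S.plusOut v) (by simp)).left_unique (S.step_plusArrival v)
  refine ⟨↑s, fun p hp => hsub p (List.mem_append_left _ hp), ?_⟩
  rw [hW, cyclicSteps_cons, hs, ha]
  rw [Multiset.cons_coe]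
  exact Multiset.coe_eq_coe.2 (List.perm_append_singleton _ _)

theorem isDirectedWalk_fundamentalCircuit (v : V) :
    C.IsDirectedWalk (S.fundamentalCircuit v) := by
  obtain ⟨s, hs, h⟩ := S.cyclicSteps_fundamentalCircuit v
  intro p hp
  rw [h, Multiset.mem_cons] at hp
  rcases hp with rfl | hp
  · exact ⟨S.initial_plusArrival v, (passage_iff.1 (S.minus_passage v)).2.initial_right,
      (S.inc_plusArrival v).trans (S.inc_minusOut v).symm⟩
  · exact ⟨(hs p hp).initial_left, (hs p hp).initial_right, (hs p hp).inc_opp⟩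

/-- The entries of the standard matrix depend linearly on traversal numbers. -/
theorem M_apply {P : F.CircuitPartition} (hP : C.SameDirections P) (v w : V) :
    S.M P v w = traversals (S.fundamentalCircuit v) (S.plusArrival w) -
      traversals (S.fundamentalCircuit v) (P.next (S.plusArrival w)) :=
  z_eq_traversals_sub ((S.isDirectedWalk_fundamentalCircuit v).of_sameDirections hP)
    ((hP _).1 (S.initial_plusArrival w)) (S.inc_plusArrival w) (by rw [opp_plusArrival])

/-- Steps of `C` contribute equally to both traversal numbers, so only the closing step of `C₁(C,
v)` counts, and it occurs at `v`. -/
theorem M_self [DecidableEq V] : S.M C.toCircuitPartition = 1 := by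
  classical
  ext v w
  rw [S.M_apply (fun _ => Iff.rfl), (S.step_plusArrival w).next_eq,
    traversals_eq_sum_snd _ (S.plusOut w), traversals]
  obtain ⟨s, hs, h⟩ := S.cyclicSteps_fundamentalCircuit v
  have e : s.map (fun p => if p.1 = S.plusArrival w then (1 : ℝ) else 0) =
      s.map (fun p => if p.2 = S.plusOut w then (1 : ℝ) else 0) := by
    refine Multiset.map_congr rfl fun p hp => ?_
    have st := S.step_plusArrival w
    have : p.1 = S.plusArrival w ↔ p.2 = S.plusOut w :=
      ⟨fun h => (hs p hp).right_unique (h ▸ st), fun h => (hs p hp).left_unique (h ▸ st)⟩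
    simp only [this]
  have n1 : S.minusOut v ≠ S.plusOut w := by
    intro h'
    have hvw : v = w := by rw [← S.inc_minusOut v, h', S.inc_plusOut]
    subst hvw
    exact S.plus_ne_minus v h'.symm
  have n2 : S.plusArrival v = S.plusArrival w ↔ v = w :=
    ⟨fun h' => by rw [← S.inc_plusArrival v, h', S.inc_plusArrival], fun h' => h' ▸ rfl⟩
  rw [h, Multiset.map_cons, Multiset.map_cons, Multiset.sum_cons, Multiset.sum_cons, e,
    if_neg n1]
  simp [n2, Matrix.one_apply]

theorem flow_eq_sum_mul_M [Fintype V] [DecidableEq V] {f : H → ℝ} (hf : C.IsFlow f)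
    {P : F.CircuitPartition} (hP : C.SameDirections P) (w : V) :
    f (S.plusArrival w) - f (P.next (S.plusArrival w)) =
      ∑ u, (f (S.plusArrival u) - f (C.next (S.plusArrival u))) * S.M P u w := by
  set c : V → ℝ := fun u => f (S.plusArrival u) - f (C.next (S.plusArrival u)) with hc
  -- By `M_self`, all coordinates of `g` with respect to `C` vanish.
  set g : H → ℝ := fun h => f h - ∑ u, c u * traversals (S.fundamentalCircuit u) h with hg
  have hflow : C.IsFlow g :=
    hf.sub_sum fun u => (S.isDirectedWalk_fundamentalCircuit u).isFlow
  have hsub : ∀ x y, g x - g y = f x - f y - ∑ u, c u *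
      (traversals (S.fundamentalCircuit u) x - traversals (S.fundamentalCircuit u) y) := by
    intro x y
    simp only [hg, mul_sub, Finset.sum_sub_distrib]
    ring
  have hplus : ∀ w, g (S.plusArrival w) - g (C.next (S.plusArrival w)) = 0 := by
    intro w
    rw [hsub]
    simp only [← S.M_apply (P := C.toCircuitPartition) (fun _ => Iff.rfl), M_self,
      Matrix.one_apply]
    simp [hc]
  have hstep : ∀ x k, C.Step x k → g x = g k := by
    intro x k hxk
    have hw := hplus (F.inc k)
    rw [← hxk.next_eq]
    -- `hplus` covers one arrival at each vertex; `sub_next` transfers it to the other.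
    by_cases hx : S.plusArrival (F.inc k) = x
    · rw [hx] at hw
      linarith
    · have := hflow.sub_next (S.initial_plusArrival _) hxk.initial_left hx
        ((S.inc_plusArrival _).trans hxk.inc_opp.symm)
      linarith
  have ha := (hP _).1 (S.initial_plusArrival w)
  have key := C.eq_of_inc_eq hstep (S.initial_plusArrival w)
    ((hP _).2 ha.step_next.initial_right) ha.step_next.inc_opp
  have h0 := hsub (S.plusArrival w) (P.next (S.plusArrival w))
  simp only [← S.M_apply hP] at h0
  linarith

open Classical in
/-- The sign that compares the directions of `e_w` given by two signed Euler systems. -/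
noncomputable def relSign {C' : F.EulerSystem} (S' : C'.SignedVersion) (w : V) : ℝ :=
  if S.plusArrival w = S'.plusArrival w then 1 else -1

theorem relSign_mul_self {C' : F.EulerSystem} (S' : C'.SignedVersion) (w : V) :
    S.relSign S' w * S.relSign S' w = 1 := by
  unfold relSign
  split_ifs <;> norm_num

theorem sub_next_eq_relSign_mul {C' : F.EulerSystem} (S' : C'.SignedVersion)
    {P : F.CircuitPartition} (hP : C.SameDirections P) (hP' : C'.SameDirections P)
    {f : H → ℝ} (hf : P.IsFlow f) (w : V) :
    f (S'.plusArrival w) - f (P.next (S'.plusArrival w)) =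
      (f (S.plusArrival w) - f (P.next (S.plusArrival w))) * S.relSign S' w := by
  unfold relSign
  split_ifs with h
  · rw [h, mul_one]
  · rw [hf.sub_next ((hP _).1 (S.initial_plusArrival w)) ((hP' _).1 (S'.initial_plusArrival w)) h
      ((S.inc_plusArrival w).trans (S'.inc_plusArrival w).symm)]
    ring

theorem M_eq_mul [Fintype V] [DecidableEq V] {C' : F.EulerSystem} (S' : C'.SignedVersion)
    (hCC' : C.SameDirections C'.toCircuitPartition) {P : F.CircuitPartition}
    (hP : C.SameDirections P) :
    S'.M P = S'.M C.toCircuitPartition * Matrix.diagonal (S.relSign S') * S.M P *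
      Matrix.diagonal (S.relSign S') := by
  have hC'C : C'.SameDirections C.toCircuitPartition := fun h => (hCC' h).symm
  have hP' : C'.SameDirections P := fun h => (hC'C h).trans (hP h)
  ext v w
  have hd := S'.isDirectedWalk_fundamentalCircuit v
  have hC := (hd.of_sameDirections hC'C).isFlow
  rw [Matrix.mul_diagonal, Matrix.mul_apply, S'.M_apply hP',
    S.sub_next_eq_relSign_mul S' hP hP' (hd.of_sameDirections hP').isFlow,
    S.flow_eq_sum_mul_M hC hP]
  congr 1
  refine Finset.sum_congr rfl fun u _ => ?_
  -- The sign enters once through the directions used by `S'.M` and once through the diagonal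
  -- factor, so it cancels.
  rw [Matrix.mul_diagonal, S'.M_apply hC'C,
    S.sub_next_eq_relSign_mul S' (fun _ => Iff.rfl) hC'C hC,
    mul_assoc _ (S.relSign S' u) (S.relSign S' u), relSign_mul_self, mul_one]

end SignedVersion

end EulerSystem

end FourRegularGraph

theorem mainTheorem6 {V H : Type*} [Fintype V] [DecidableEq V] (F : FourRegularGraph V H)
    (C C' : F.EulerSystem) (hCC' : C.SameDirections C'.toCircuitPartition)
    (S : C.SignedVersion) (S' : C'.SignedVersion) :
    ∃ Δ : Matrix V V ℝ,
      (∀ v, Δ v v = 1 ∨ Δ v v = -1) ∧ (∀ v w, v ≠ w → Δ v w = 0) ∧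
      IsUnit (S.M C'.toCircuitPartition) ∧
      S'.M C.toCircuitPartition = Δ * (S.M C'.toCircuitPartition)⁻¹ * Δ ∧
      ∀ P : F.CircuitPartition, C.SameDirections P →
        S'.M P = S'.M C.toCircuitPartition * Δ * S.M P * Δ := by
  have hΔ : Matrix.diagonal (S.relSign S') * Matrix.diagonal (S.relSign S') = 1 := by
    rw [Matrix.diagonal_mul_diagonal, ← Matrix.diagonal_one]
    exact congrArg _ (funext (S.relSign_mul_self S'))
  have hM := S.M_eq_mul S' hCC' hCC'
  have hall := fun P => S.M_eq_mul S' hCC' (P := P)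
  have hdiag : ∀ v, Matrix.diagonal (S.relSign S') v v = 1 ∨
      Matrix.diagonal (S.relSign S') v v = -1 := by
    intro v
    rw [Matrix.diagonal_apply_eq, FourRegularGraph.EulerSystem.SignedVersion.relSign]
    split_ifs <;> simp
  have hoff : ∀ v w, v ≠ w → Matrix.diagonal (S.relSign S') v w = 0 :=
    fun v w h => Matrix.diagonal_apply_ne _ h
  generalize Matrix.diagonal (S.relSign S') = Δ at *
  rw [S'.M_self] at hM
  generalize S'.M C.toCircuitPartition = N at *
  generalize S.M C'.toCircuitPartition = A at *
  -- `hM` now reads `1 = N * Δ * A * Δ`; conjugating by the involution `Δ` gives a left inverse of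
  -- `A`.
  have hinv : Δ * N * Δ * A = 1 := by
    calc Δ * N * Δ * A = Δ * (N * Δ * A * Δ) * Δ := by
          simp only [Matrix.mul_assoc, hΔ, Matrix.mul_one]
      _ = 1 := by rw [← hM, Matrix.mul_one, hΔ]
  refine ⟨Δ, hdiag, hoff, IsUnit.of_mul_eq_one_right _ hinv, ?_, hall⟩
  rw [Matrix.inv_eq_left_inv hinv]
  simp only [Matrix.mul_assoc, hΔ, Matrix.mul_one]
  rw [← Matrix.mul_assoc Δ Δ, hΔ, Matrix.one_mul]
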